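/- Let $\{\mathbf X_t\},\{\mathbf Y_t\},\{\mathbf Z_t\}$ ($t\in\mathbb Z$) be real, finite-dimensional multivariate time series with square-integrable components on one probability space, each weakly stationary (constant mean, and $\mathrm{Cov}(\mathbf X_{t+h},\mathbf X_t)$ depends only on $h$, etc.) and pairwise jointly weakly stationary ($\mathrm{Cov}(\mathbf X_{t+h},\mathbf Y_t)$ depends only on $h$, etc.). For $\mathbf U,\mathbf V\in\{\mathbf X,\mathbf Y,\mathbf Z\}$ put $\Gamma_{\mathbf{UV}}(h)=\mathrm{Cov}(\mathbf U_{t+h},\mathbf V_t)$, and assume that $\mathbf U,\mathbf V$ have a (cross-)spectral density $S_{\mathbf{UV}}$, i.e. an integrable complex matrix function on $[-\pi,\pi]$ with $$\Gamma_{\mathbf{UV}}(h)=\frac1{2\pi}\int_{-\pi}^{\pi}e^{i\lambda h}S_{\mathbf{UV}}(\lambda)\,d\lambda\qquad(h\in\mathbb Z)$$ (if $\Gamma_{\mathbf{UV}}$ is absolutely summable, this holds for $S_{\mathbf{UV}}(\lambda)=\sum_h e^{-ih\lambda}\Gamma_{\mathbf{UV}}(h)$). Write $S_{\mathbf U}=S_{\mathbf{UU}}$,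 and assume that $S_{\mathbf Z}(\lambda)$ is nonsingular for almost every $\lambda\in[-\pi,\pi]$. For $\mathbf U,\mathbf V\in\{\mathbf X,\mathbf Y\}$ define the conditional spectral densities $$S_{\mathbf{UV}|\mathbf Z}=S_{\mathbf{UV}}-S_{\mathbf{UZ}}\,S_{\mathbf Z}^{-1}\,S_{\mathbf{ZV}},\qquad S_{\mathbf U|\mathbf Z}=S_{\mathbf{UU}|\mathbf Z},$$ and let $\langle S\rangle=\frac1{2\pi}\int_{-\pi}^{\pi}S(\lambda)\,d\lambda$. Let $E[\mathbf U_t\,|\,\{\mathbf Z_t\}]$ be the optimal linear predictor of $\mathbf U_t$ from the whole process $\{\mathbf Z_s\}_{s\in\mathbb Z}$, that is, the componentwise orthogonal projection in $L^2$ onto the closed linear span of the constant $1$ and all components of all $\mathbf Z_s$ (the constant is irrelevant for centred series), and let $\mathrm{Cov}[\mathbf U_t,\mathbf V_t\,|\,\{\mathbf Z_t\}]$ be the covariance matrix of the prediction errors $\mathbf U_t-E[\mathbf U_t|\{\mathbf Z_t\}]$ and $\mathbf V_t-E[\mathbf V_t|\{\mathbf Z_t\}]$, with $\mathrm{Var}[\mathbf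 U_t\,|\,\{\mathbf Z_t\}]=\mathrm{Cov}[\mathbf U_t,\mathbf U_t\,|\,\{\mathbf Z_t\}]$. Then $S_{\mathbf X|\mathbf Z}$, $S_{\mathbf Y|\mathbf Z}$, $S_{\mathbf{XY}|\mathbf Z}$, $S_{\mathbf{YX}|\mathbf Z}$ are integrable on $[-\pi,\pi]$, and for every $t\in\mathbb Z$ $$\mathrm{Var}[\mathbf X_t|\{\mathbf Z_t\}]=\langle S_{\mathbf X|\mathbf Z}\rangle,\qquad \mathrm{Var}[\mathbf Y_t|\{\mathbf Z_t\}]=\langle S_{\mathbf Y|\mathbf Z}\rangle,\qquad \mathrm{Cov}[\mathbf X_t,\mathbf Y_t|\{\mathbf Z_t\}]=\langle S_{\mathbf{XY}|\mathbf Z}\rangle .$$ Moreover, if $\langle S_{\mathbf X|\mathbf Z}\rangle$ is positive definite, then the quantity $$1-\frac{\det\!\left[\langle S_{\mathbf{XY}|\mathbf Z}\rangle\,\langle S_{\mathbf Y|\mathbf Z}\rangle^{-1}\,\langle S_{\mathbf{YX}|\mathbf Z}\rangle\right]}{\det\langle S_{\mathbf X|\mathbf Z}\rangle}$$ is real and lies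 in $[0,1]$. (This presupposes that $\langle S_{\mathbf Y|\mathbf Z}\rangle$ is nonsingular; with the convention that the inverse of a singular matrix is $0$, it holds in general.) -/

import Mathlib

open MeasureTheory ProbabilityTheory
open scoped ComplexOrder

noncomputable section

/-- A real multivariate time series over `Ω` with components indexed by `ι`:
`X t ω i` is the `i`-th coordinate of the random vector `X_t` at `ω`. -/
abbrev TimeSeries (Ω ι : Type*) := ℤ → Ω → ι → ℝ

section Stationarity

variable {Ω ι κ : Type*} [MeasurableSpace Ω]

/-- The matrix `Cov (X_s, Y_t)`. -/
def crossCov (μ : Measure Ω) (X : TimeSeries Ω ι) (Y : TimeSeries Ω κ) (s t : ℤ) :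
    Matrix ι κ ℝ :=
  Matrix.of fun i j => cov[fun ω => X s ω i, fun ω => Y t ω j; μ]

/-- Weak (second-order) stationarity: square integrable components, constant mean, and
`Cov (X_{t+h}, X_t)` depends only on the lag `h`. -/
structure IsWeaklyStationary (μ : Measure Ω) (X : TimeSeries Ω ι) : Prop where
  memLp : ∀ t i, MemLp (fun ω => X t ω i) 2 μ
  mean_eq : ∀ t i, ∫ ω, X t ω i ∂μ = ∫ ω, X 0 ω i ∂μ
  cov_eq : ∀ t h, crossCov μ X X (t + h) t = crossCov μ X X h 0

/-- For weakly stationary `X` and `Y`: they are jointly weakly stationary if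
`Cov (X_{t+h}, Y_t)` depends only on the lag `h`. -/
def IsJointlyWeaklyStationary (μ : Measure Ω) (X : TimeSeries Ω ι) (Y : TimeSeries Ω κ) : Prop :=
  ∀ t h, crossCov μ X Y (t + h) t = crossCov μ X Y h 0

/-- The cross-covariance function `Γ_{XY}(h)`, i.e. the common value of `Cov (X_{t+h}, Y_t)`. -/
def crossCovFun (μ : Measure Ω) (X : TimeSeries Ω ι) (Y : TimeSeries Ω κ) (h : ℤ) :
    Matrix ι κ ℝ :=
  crossCov μ X Y h 0

end Stationarity

section Spectral

/-- Entrywise integrability over `[-π, π]` of a matrix function of the frequency. -/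
def FreqIntegrable {ι κ : Type*} (S : ℝ → Matrix ι κ ℂ) : Prop :=
  ∀ i j, IntervalIntegrable (fun w => S w i j) volume (-Real.pi) Real.pi

/-- The frequency average `⟨S⟩ = (2π)⁻¹ ∫_{-π}^{π} S(w) dw`, taken entrywise. -/
def freqAvg {ι κ : Type*} (S : ℝ → Matrix ι κ ℂ) : Matrix ι κ ℂ :=
  Matrix.of fun i j =>
    (2 * (Real.pi : ℂ))⁻¹ * ∫ w in (-Real.pi)..Real.pi, S w i j

/-- `S` is a (cross-)spectral density of `X` and `Y`: an integrable matrix function whose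
Fourier coefficients are the cross-covariances,
`Γ_{XY}(h) = (2π)⁻¹ ∫_{-π}^{π} e^{i w h} S(w) dw` for every lag `h`.
For `Y = X` this is a spectral density of `X`. -/
structure HasCrossSpectralDensity {Ω ι κ : Type*} [MeasurableSpace Ω] (μ : Measure Ω)
    (X : TimeSeries Ω ι) (Y : TimeSeries Ω κ) (S : ℝ → Matrix ι κ ℂ) : Prop where
  integrable : FreqIntegrable S
  fourier : ∀ h : ℤ, (crossCovFun μ X Y h).map (fun x : ℝ => (x : ℂ)) =
    freqAvg fun w => Complex.exp (Complex.I * w * h) • S w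

/-- If the cross-covariances are absolutely summable, then the Fourier series
`∑ₕ e^{-i h w} Γ_{XY}(h)` is a cross-spectral density in the above sense. -/
theorem HasCrossSpectralDensity.of_summable {Ω ι κ : Type*} [MeasurableSpace Ω] (μ : Measure Ω)
    (X : TimeSeries Ω ι) (Y : TimeSeries Ω κ)
    (hsum : ∀ i j, Summable fun h : ℤ => |crossCovFun μ X Y h i j|) :
    HasCrossSpectralDensity μ X Y fun w => Matrix.of fun i j =>
      ∑' h : ℤ, Complex.exp (-(Complex.I * h * w)) * (crossCovFun μ X Y h i j : ℂ) := by
  have hnorm : ∀ (h : ℤ) (w : ℝ), ‖Complex.exp (-(Complex.I * h * w))‖ = 1 := by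
    intro h w
    have : -(Complex.I * h * w) = ((-(h * w) : ℝ) : ℂ) * Complex.I := by push_cast; ring
    rw [this, Complex.norm_exp_ofReal_mul_I]
  have hcont : ∀ i j, Continuous fun w : ℝ =>
      ∑' h : ℤ, Complex.exp (-(Complex.I * h * w)) * (crossCovFun μ X Y h i j : ℂ) := by
    intro i j
    refine continuous_tsum (fun h => by fun_prop) (hsum i j) fun h w => ?_
    simp [hnorm]
  refine ⟨fun i j => (hcont i j).intervalIntegrable _ _, fun h => ?_⟩
  ext i j
  simp only [Matrix.map_apply, freqAvg, Matrix.of_apply, Matrix.smul_apply, smul_eq_mul]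
  have key : ∀ k : ℤ, ∫ w in (-Real.pi)..Real.pi, Complex.exp (Complex.I * w * h) *
      (Complex.exp (-(Complex.I * k * w)) * (crossCovFun μ X Y k i j : ℂ)) =
      if k = h then 2 * (Real.pi : ℂ) * (crossCovFun μ X Y h i j : ℂ) else 0 := by
    intro k
    have e : ∀ w : ℝ, Complex.exp (Complex.I * w * h) *
        (Complex.exp (-(Complex.I * k * w)) * (crossCovFun μ X Y k i j : ℂ)) =
        Complex.exp ((Complex.I * (h - k)) * w) * (crossCovFun μ X Y k i j : ℂ) := by
      intro w
      rw [← mul_assoc, ← Complex.exp_add]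
      ring_nf
    simp_rw [e]
    rw [intervalIntegral.integral_mul_const]
    split_ifs with hk
    · subst hk
      simp
      left
      ring
    · have hne : (Complex.I * ((h : ℂ) - k)) ≠ 0 :=
        mul_ne_zero Complex.I_ne_zero (sub_ne_zero.2 (by exact_mod_cast Ne.symm hk))
      rw [integral_exp_mul_complex hne]
      have : Complex.exp (Complex.I * (h - k) * (Real.pi : ℝ)) =
          Complex.exp (Complex.I * (h - k) * ((-Real.pi : ℝ) : ℂ)) := by
        rw [Complex.exp_eq_exp_iff_exists_int]
        exact ⟨h - k, by push_cast; ring⟩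
      rw [this, sub_self, zero_div, zero_mul]
  have hs := intervalIntegral.hasSum_integral_of_dominated_convergence
    (μ := volume) (a := -Real.pi) (b := Real.pi)
    (F := fun (k : ℤ) (w : ℝ) => Complex.exp (Complex.I * w * h) *
      (Complex.exp (-(Complex.I * k * w)) * (crossCovFun μ X Y k i j : ℂ)))
    (f := fun w => Complex.exp (Complex.I * w * h) *
      ∑' k : ℤ, Complex.exp (-(Complex.I * k * w)) * (crossCovFun μ X Y k i j : ℂ))
    (fun k _ => |crossCovFun μ X Y k i j|)
    (fun k => by
      apply Continuous.aestronglyMeasurable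
      fun_prop)
    (fun k => Filter.Eventually.of_forall fun w _ => by
      have h1 : ‖Complex.exp (Complex.I * w * h)‖ = 1 := by
        have := hnorm (-h) w
        rw [← this]
        congr 2
        push_cast
        ring
      simp [hnorm, h1])
    (Filter.Eventually.of_forall fun w _ => hsum i j)
    (by simp)
    (Filter.Eventually.of_forall fun w _ => by
      refine HasSum.mul_left _ (Summable.hasSum ?_)
      refine Summable.of_norm ?_
      simpa [hnorm] using hsum i j)
  simp_rw [key] at hs
  rw [← hs.tsum_eq, tsum_ite_eq]
  have hpi : (Real.pi : ℂ) ≠ 0 := by exact_mod_cast Real.pi_ne_zero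
  field_simp

/-- The Schur complement `S_{XY|Z} = S_{XY} - S_{XZ} S_Z⁻¹ S_{ZY}`, frequency by frequency. -/
def condSpectralDensity {ι κ ν : Type*} [Fintype ν] [DecidableEq ν]
    (SXY : ℝ → Matrix ι κ ℂ) (SXZ : ℝ → Matrix ι ν ℂ) (SZ : ℝ → Matrix ν ν ℂ)
    (SZY : ℝ → Matrix ν κ ℂ) : ℝ → Matrix ι κ ℂ :=
  fun w => SXY w - SXZ w * (SZ w)⁻¹ * SZY w

end Spectral

section Prediction

variable {Ω ι κ ν : Type*} [MeasurableSpace Ω]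

open Classical in
/-- The class in `L²(μ)` of a square integrable random variable (and `0` for other functions). -/
def toL2 (μ : Measure Ω) (f : Ω → ℝ) : Lp ℝ 2 μ :=
  if hf : MemLp f 2 μ then hf.toLp f else 0

/-- The closed linear subspace of `L²(μ)` spanned by the constant `1` and all the components
`Z_{s,j}`, at all times `s : ℤ`, of the process `Z`. (The constant makes the means irrelevant;
for centred processes it does not change any prediction.) -/
def predictorSpace (μ : Measure Ω) (Z : TimeSeries Ω ν) : Submodule ℝ (Lp ℝ 2 μ) :=
  (Submodule.span ℝ (insert (toL2 μ fun _ => (1 : ℝ))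
    (Set.range fun p : ℤ × ν => toL2 μ fun ω => Z p.1 ω p.2))).topologicalClosure

/-- The optimal (mean square) linear predictor of `f` given the whole process `Z`: the
orthogonal projection of `f` onto the closed span of the process. -/
def linearPredictor (μ : Measure Ω) (Z : TimeSeries Ω ν) (f : Ω → ℝ) : Lp ℝ 2 μ :=
  haveI : CompleteSpace (predictorSpace μ Z) :=
    (Submodule.isClosed_topologicalClosure _).completeSpace_coe
  (predictorSpace μ Z).starProjection (toL2 μ f)

/-- The residual process `X_t - E[X_t | {Z_t}]` of linear prediction from the whole process `Z`. -/
def predResidual (μ : Measure Ω) (Z : TimeSeries Ω ν) (X : TimeSeries Ω ι) : TimeSeries Ω ι :=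
  fun t ω i => X t ω i - linearPredictor μ Z (fun ω' => X t ω' i) ω

/-- `Cov [X_t, Y_t | {Z_t}]`: the covariance matrix of the two prediction residuals at time `t`. -/
def linCondCov (μ : Measure Ω) (X : TimeSeries Ω ι) (Y : TimeSeries Ω κ) (Z : TimeSeries Ω ν)
    (t : ℤ) : Matrix ι κ ℝ :=
  crossCov μ (predResidual μ Z X) (predResidual μ Z Y) t t

/-- `Var [X_t | {Z_t}]`. -/
def linCondVar (μ : Measure Ω) (X : TimeSeries Ω ι) (Z : TimeSeries Ω ν) (t : ℤ) : Matrix ι ι ℝ :=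
  linCondCov μ X X Z t

end Prediction

end

noncomputable section

/-! ### Fourier analysis on `(-π, π]` and the `L¹` bound for cross-spectral densities. -/

section FrequencyMeasure

open Filter Topology

/-! Let `x` be a centred component of `X_t` and `ξ` its projection onto the closed span of the
centred `Z`. The error covariance with a component `y` of `Y_t` is `⟪x, y⟫ - ⟪ξ, y⟫`, so everything
rests on showing that `ξ` and `y` have cross-spectral density `S_{xz} S_z⁻¹ S_{zy}`
(`integral_transfer_eq_inner`).

Finite combinations `ξ_n → ξ` of the `Z_{s,j}` have trigonometric-polynomial transfer functions
`p_n`, and their densities with `z` and `y` are `p_n S_z` and `p_n S_{zy}`. By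
`integral_norm_le_of_inner`, a density of `η` with a stationary family has `L¹` norm at most a
constant times `‖η‖`. Hence `p_n S_z → e^{iwt} S_{xz}` and `p_n S_{zy}` converges in `L¹`, and along
a subsequence both converge almost everywhere. Where `S_z` is invertible this forces `p_n → e^{iwt}
S_{xz} S_z⁻¹`, which identifies the second limit. Neither the space `L²(S_z)` nor positivity of the
densities enters.

For the determinants, the error covariances form a Gram matrix with blocks `A, B, Bᵀ, D`. Its Schur
complement gives `0 ≤ B D⁻¹ Bᵀ ≤ A`, and the determinant is monotone on positive semidefinite
matrices. -/

instance fact_two_pi_pos : Fact (0 < 2 * Real.pi) := ⟨Real.two_pi_pos⟩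

/-- Normalized Lebesgue measure on `(-π, π]`. -/
def freqMeasure : Measure ℝ :=
  ENNReal.ofReal (2 * Real.pi)⁻¹ • volume.restrict (Set.Ioc (-Real.pi) Real.pi)

instance isFiniteMeasure_freqMeasure : IsFiniteMeasure freqMeasure := by
  unfold freqMeasure
  exact Measure.smul_finite _ ENNReal.ofReal_ne_top

theorem freqMeasure_real_univ : freqMeasure.real Set.univ = 1 := by
  have hpi := Real.pi_pos
  have h : Real.pi + Real.pi = 2 * Real.pi := by ring
  simp only [freqMeasure, measureReal_ennreal_smul_apply, measureReal_restrict_apply_univ,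
    Real.volume_real_Ioc, sub_neg_eq_add, h]
  rw [ENNReal.toReal_ofReal (by positivity), max_eq_left (by positivity)]
  field_simp

theorem integrable_freqMeasure_iff {E : Type*} [NormedAddCommGroup E] {f : ℝ → E} :
    Integrable f freqMeasure ↔ IntervalIntegrable f volume (-Real.pi) Real.pi := by
  have hpi := Real.pi_pos
  rw [freqMeasure, integrable_smul_measure (by simpa using hpi) ENNReal.ofReal_ne_top,
    intervalIntegrable_iff_integrableOn_Ioc_of_le (by linarith)]
  rfl

theorem integral_freqMeasure (f : ℝ → ℂ) :
    ∫ w, f w ∂freqMeasure =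
      (2 * (Real.pi : ℂ))⁻¹ * ∫ w in (-Real.pi)..Real.pi, f w := by
  have hpi := Real.pi_pos
  rw [freqMeasure, integral_smul_measure, intervalIntegral.integral_of_le (by linarith),
    ENNReal.toReal_ofReal (by positivity), Complex.real_smul]
  push_cast
  rfl

theorem ae_freqMeasure {p : ℝ → Prop}
    (h : ∀ᵐ w ∂(volume.restrict (Set.Icc (-Real.pi) Real.pi)), p w) :
    ∀ᵐ w ∂freqMeasure, p w := by
  refine Measure.ae_smul_measure ?_ _
  exact ae_mono (Measure.restrict_mono Set.Ioc_subset_Icc_self le_rfl) h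

/-- The character `w ↦ e^{i w n}`. -/
def character (n : ℤ) (w : ℝ) : ℂ := Complex.exp (Complex.I * w * n)

theorem continuous_character (n : ℤ) : Continuous (character n) := by
  unfold character
  fun_prop

theorem norm_character (n : ℤ) (w : ℝ) : ‖character n w‖ = 1 := by
  have : Complex.I * w * n = ((w * n : ℝ) : ℂ) * Complex.I := by push_cast; ring
  rw [character, this, Complex.norm_exp_ofReal_mul_I]

theorem character_add (m n : ℤ) (w : ℝ) :
    character (m + n) w = character m w * character n w := by
  rw [character, character, character, ← Complex.exp_add]
  push_cast
  ring_nf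

@[simp]
theorem character_zero (w : ℝ) : character 0 w = 1 := by simp [character]

theorem conj_character (n : ℤ) (w : ℝ) :
    (starRingEnd ℂ) (character n w) = character (-n) w := by
  rw [character, character, ← Complex.exp_conj]
  simp

theorem fourier_eq_character (n : ℤ) (w : ℝ) :
    fourier n (w : AddCircle (2 * Real.pi)) = character n w := by
  have hpi : (Real.pi : ℂ) ≠ 0 := by exact_mod_cast Real.pi_ne_zero
  rw [fourier_coe_apply, character]
  congr 1
  push_cast
  field_simp

theorem MeasureTheory.Integrable.character_mul {f : ℝ → ℂ} (hf : Integrable f freqMeasure) (n : ℤ) :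
    Integrable (fun w => character n w * f w) freqMeasure :=
  hf.bdd_mul (continuous_character n).aestronglyMeasurable
    (Eventually.of_forall fun w => (norm_character n w).le)

/-- The trigonometric polynomial with coefficients `c`. -/
def trigPoly (c : ℤ →₀ ℂ) (w : ℝ) : ℂ := ∑ n ∈ c.support, c n * character n w

theorem continuous_trigPoly (c : ℤ →₀ ℂ) : Continuous (trigPoly c) :=
  continuous_finsetSum _ fun n _ => continuous_const.mul (continuous_character n)

theorem exists_trigPoly_approx (g : C(AddCircle (2 * Real.pi), ℂ)) {ε : ℝ} (hε : 0 < ε) :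
    ∃ c : ℤ →₀ ℂ, ∀ w : ℝ, ‖g w - trigPoly c w‖ ≤ ε := by
  have hg : g ∈ (Submodule.span ℂ (Set.range (@fourier (2 * Real.pi)))).topologicalClosure := by
    rw [span_fourier_closure_eq_top]
    trivial
  obtain ⟨p, hp, hgp⟩ := Metric.mem_closure_iff.1 hg ε hε
  obtain ⟨c, rfl⟩ := Finsupp.mem_span_range_iff_exists_finsupp.1 hp
  refine ⟨c, fun w => ?_⟩
  have h := (ContinuousMap.dist_apply_le_dist (f := g) (w : AddCircle (2 * Real.pi))).trans hgp.le
  rw [dist_eq_norm] at h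
  have e : (c.sum fun n a => a • fourier n : C(AddCircle (2 * Real.pi), ℂ)) w = trigPoly c w := by
    rw [Finsupp.sum, ContinuousMap.sum_apply, trigPoly]
    refine Finset.sum_congr rfl fun n _ => ?_
    rw [ContinuousMap.smul_apply, fourier_eq_character, smul_eq_mul]
  rwa [e] at h

/-- Density of continuous functions in `L¹` is applied on the circle rather than on the interval, so
that the approximant is periodic and uniform approximation by trigonometric polynomials applies to
it. -/
theorem AddCircle.exists_continuous_approx {T : ℝ} [hT : Fact (0 < T)] (a : ℝ) {f : ℝ → ℂ}
    (hf : IntegrableOn f (Set.Ioc a (a + T))) {ε : ℝ} (hε : 0 < ε) :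
    ∃ g : C(AddCircle T, ℂ), ∫ w in Set.Ioc a (a + T), ‖f w - g w‖ ≤ ε := by
  have hmk := AddCircle.measurePreserving_mk T a
  have hF : Integrable (fun x => f (AddCircle.equivIoc T a x : ℝ))
      (volume : Measure (AddCircle T)) := by
    have h1 := (integrableOn_iff_comap_subtypeVal measurableSet_Ioc).1 hf
    have h2 := AddCircle.measurePreserving_equivIoc T (a := a)
    exact h2.integrable_comp_of_integrable (g := fun x : Set.Ioc a (a + T) => f x) h1
  obtain ⟨g, hg, hgi⟩ := hF.exists_boundedContinuous_integral_sub_le hε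
  refine ⟨g.toContinuousMap, ?_⟩
  rw [← hmk.map_eq, integral_map hmk.measurable.aemeasurable] at hg
  · convert hg using 1
    refine setIntegral_congr_fun measurableSet_Ioc fun w hw => ?_
    rw [AddCircle.equivIoc_coe_of_mem hw]
    rfl
  · rw [hmk.map_eq]
    exact (hF.sub hgi).norm.aestronglyMeasurable

theorem exists_periodic_continuous_approx {f : ℝ → ℂ} (hf : Integrable f freqMeasure) {ε : ℝ}
    (hε : 0 < ε) : ∃ g : C(AddCircle (2 * Real.pi), ℂ),
      ∫ w, ‖f w - g w‖ ∂freqMeasure ≤ ε := by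
  have hpi := Real.pi_pos
  have hI : -Real.pi + 2 * Real.pi = Real.pi := by ring
  have hfi : IntegrableOn f (Set.Ioc (-Real.pi) (-Real.pi + 2 * Real.pi)) := by
    rw [hI]
    exact (intervalIntegrable_iff_integrableOn_Ioc_of_le (by linarith)).1
      (integrable_freqMeasure_iff.1 hf)
  obtain ⟨g, hg⟩ := AddCircle.exists_continuous_approx (-Real.pi) hfi
    (ε := 2 * Real.pi * ε) (by positivity)
  refine ⟨g, ?_⟩
  rw [freqMeasure, integral_smul_measure, ENNReal.toReal_ofReal (by positivity), smul_eq_mul,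
    inv_mul_le_iff₀ (by positivity)]
  rwa [hI] at hg

/-- `L¹`–`L^∞` duality: the `L¹` norm is attained by testing against the conjugate phase of `f`,
which trigonometric polynomials of sup norm at most `1` approximate well enough. -/
theorem integral_norm_le_of_trigPoly {f : ℝ → ℂ} (hf : Integrable f freqMeasure) {C : ℝ}
    (h : ∀ c : ℤ →₀ ℂ, (∀ w, ‖trigPoly c w‖ ≤ 1) →
      ‖∫ w, f w * trigPoly c w ∂freqMeasure‖ ≤ C) :
    ∫ w, ‖f w‖ ∂freqMeasure ≤ C := by
  have key : ∀ ε : ℝ, 0 < ε → ε < 1 →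
      ∫ w, ‖f w‖ ∂freqMeasure ≤ C + 2 * ε + 2 * ε * ∫ w, ‖f w‖ ∂freqMeasure + ε := by
    intro ε hε hε1
    obtain ⟨g, hg⟩ := exists_periodic_continuous_approx hf hε
    have hgpos : ∀ x, (0 : ℝ) < ‖g x‖ + ε := fun x => by positivity
    -- A continuous substitute for the phase `conj g / ‖g‖`: the `ε` in the denominator removes the
    -- singularity at zeros of `g` and costs at most `ε` in `g * h0`.
    let h0 : C(AddCircle (2 * Real.pi), ℂ) :=
      ⟨fun x => (starRingEnd ℂ) (g x) / ((‖g x‖ + ε : ℝ) : ℂ), by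
        refine Continuous.div (by fun_prop) (by fun_prop) fun x => ?_
        exact_mod_cast (hgpos x).ne'⟩
    have hh0 : ∀ x, ‖h0 x‖ ≤ 1 := by
      intro x
      change ‖(starRingEnd ℂ) (g x) / ((‖g x‖ + ε : ℝ) : ℂ)‖ ≤ 1
      rw [norm_div, RCLike.norm_conj, Complex.norm_real, Real.norm_eq_abs, abs_of_pos (hgpos x),
        div_le_one (hgpos x)]
      linarith
    -- Shrinking `h0` by `1 - ε` leaves room for the approximation error, so the polynomial stays
    -- bounded by `1`.
    obtain ⟨c, hc⟩ := exists_trigPoly_approx (((1 - ε : ℝ) : ℂ) • h0) hε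
    have hc' : ∀ w : ℝ, ‖((1 - ε : ℝ) : ℂ) * h0 w - trigPoly c w‖ ≤ ε := hc
    have hnorm : ∀ w : ℝ, ‖((1 - ε : ℝ) : ℂ) * h0 w‖ ≤ 1 - ε := by
      intro w
      rw [norm_mul, Complex.norm_real, Real.norm_eq_abs, abs_of_pos (by linarith)]
      exact mul_le_of_le_one_right (by linarith) (hh0 _)
    have hc1 : ∀ w, ‖trigPoly c w‖ ≤ 1 := by
      intro w
      have := norm_sub_norm_le (trigPoly c w) (((1 - ε : ℝ) : ℂ) * h0 w)
      rw [norm_sub_rev] at this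
      linarith [hc' w, hnorm w]
    have hfp : Integrable (fun w => f w * trigPoly c w) freqMeasure :=
      hf.mul_bdd (continuous_trigPoly c).aestronglyMeasurable (Eventually.of_forall hc1)
    have hgc : Integrable (fun w : ℝ => g w) freqMeasure := by
      refine Integrable.of_bound
        (g.continuous.comp (AddCircle.continuous_mk' _)).aestronglyMeasurable ‖g‖
        (Eventually.of_forall fun w => g.norm_coe_le_norm _)
    -- Replacing `f` by `g` costs `‖f - g‖` twice, replacing `h0` by the polynomial costs `2ε‖f‖`,
    -- and the regularised phase costs `ε`.
    have hpt : ∀ w : ℝ, ‖f w‖ ≤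
        (f w * trigPoly c w).re + 2 * ‖f w - g w‖ + 2 * ε * ‖f w‖ + ε := by
      intro w
      have e1 : ‖f w‖ ≤ ‖f w - g w‖ + ‖g w‖ := by
        simpa using norm_add_le (f w - g w) (g w)
      have e2 : ‖g w‖ - ε ≤ (g w * h0 w).re := by
        have : g w * h0 w = ((‖g w‖ ^ 2 / (‖g w‖ + ε) : ℝ) : ℂ) := by
          change g w * ((starRingEnd ℂ) (g w) / ((‖g w‖ + ε : ℝ) : ℂ)) = _
          rw [← mul_div_assoc, Complex.mul_conj, Complex.normSq_eq_norm_sq]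
          push_cast
          rfl
        rw [this, Complex.ofReal_re, le_div_iff₀ (hgpos _)]
        nlinarith
      have e3 : g w * h0 w = f w * trigPoly c w + (g w - f w) * h0 w +
          f w * (h0 w - trigPoly c w) := by ring
      have e4 : ((g w - f w) * h0 w).re ≤ ‖f w - g w‖ := by
        refine (Complex.re_le_norm _).trans ?_
        rw [norm_mul, norm_sub_rev]
        exact mul_le_of_le_one_right (norm_nonneg _) (hh0 _)
      have e5 : ‖h0 w - trigPoly c w‖ ≤ 2 * ε := by
        have : h0 w - trigPoly c w =
            ((ε : ℝ) : ℂ) * h0 w + (((1 - ε : ℝ) : ℂ) * h0 w - trigPoly c w) := by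
          push_cast
          ring
        rw [this]
        refine (norm_add_le _ _).trans ?_
        have : ‖((ε : ℝ) : ℂ) * h0 w‖ ≤ ε := by
          rw [norm_mul, Complex.norm_real, Real.norm_eq_abs, abs_of_pos hε]
          exact mul_le_of_le_one_right hε.le (hh0 _)
        linarith [hc' w]
      have e6 : (f w * (h0 w - trigPoly c w)).re ≤ 2 * ε * ‖f w‖ := by
        refine (Complex.re_le_norm _).trans ?_
        rw [norm_mul, mul_comm]
        exact mul_le_mul_of_nonneg_right e5 (norm_nonneg _)
      rw [e3, Complex.add_re, Complex.add_re] at e2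
      linarith
    have i1 : Integrable (fun w => (f w * trigPoly c w).re) freqMeasure := hfp.re
    have i2 : Integrable (fun w : ℝ => 2 * ‖f w - g w‖) freqMeasure :=
      (hf.sub hgc).norm.const_mul 2
    have i3 : Integrable (fun w => 2 * ε * ‖f w‖) freqMeasure := hf.norm.const_mul _
    have hint := integral_mono hf.norm (((i1.add i2).add i3).add (integrable_const ε)) hpt
    have e7 : ∫ w, (f w * trigPoly c w).re ∂freqMeasure ≤ C := by
      have : ∫ w, (f w * trigPoly c w).re ∂freqMeasure =
          (∫ w, f w * trigPoly c w ∂freqMeasure).re := integral_re hfp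
      rw [this]
      exact (Complex.re_le_norm _).trans (h c hc1)
    have e8 : ∫ w, ((((fun w => (f w * trigPoly c w).re) + (fun w : ℝ => 2 * ‖f w - g w‖) +
        fun w => 2 * ε * ‖f w‖) + fun _ => ε) : ℝ → ℝ) w ∂freqMeasure =
        ∫ w, (f w * trigPoly c w).re ∂freqMeasure + 2 * ∫ w, ‖f w - g w‖ ∂freqMeasure +
        2 * ε * ∫ w, ‖f w‖ ∂freqMeasure + ε := by
      rw [integral_add' ((i1.add i2).add i3) (integrable_const ε), integral_add' (i1.add i2) i3,
        integral_add' i1 i2, integral_const_mul, integral_const_mul, integral_const,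
        freqMeasure_real_univ, one_smul]
    refine hint.trans ?_
    rw [e8]
    linarith
  have hlim : Tendsto (fun ε : ℝ => C + 2 * ε + 2 * ε * ∫ w, ‖f w‖ ∂freqMeasure + ε)
      (𝓝[>] 0) (𝓝 C) := by
    have : Continuous fun ε : ℝ => C + 2 * ε + 2 * ε * ∫ w, ‖f w‖ ∂freqMeasure + ε := by
      fun_prop
    have h0 := (this.tendsto 0).mono_left (nhdsWithin_le_nhds (s := Set.Ioi 0))
    simpa using h0
  refine ge_of_tendsto hlim ?_
  filter_upwards [Ioo_mem_nhdsGT (show (0 : ℝ) < 1 by norm_num)] with ε hε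
  exact key ε hε.1 hε.2

/-- If `f` represents the functional `⟪η, ·⟫` on a stationary family `y` with spectral density
`σ`, then its `L¹` norm is controlled by `‖η‖`. -/
theorem integral_norm_le_of_inner {H : Type*} [NormedAddCommGroup H] [InnerProductSpace ℝ H]
    {y : ℤ → H} {η : H} {f σ : ℝ → ℂ} (hf : Integrable f freqMeasure)
    (hσ : Integrable σ freqMeasure)
    (hfy : ∀ τ, ∫ w, character (-τ) w * f w ∂freqMeasure = (inner ℝ η (y τ) : ℝ))
    (hσy : ∀ s t, ∫ w, character (s - t) w * σ w ∂freqMeasure = (inner ℝ (y s) (y t) : ℝ)) :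
    ∫ w, ‖f w‖ ∂freqMeasure ≤ ‖η‖ * √(∫ w, ‖σ w‖ ∂freqMeasure) := by
  refine integral_norm_le_of_trigPoly hf fun c hc => ?_
  -- The real and imaginary parts of `∑ c_n y(-n)`, kept apart because `H` is a real space. The
  -- index is `-n` because `y τ` is paired with the character of `-τ`.
  set a : H := ∑ n ∈ c.support, (c n).re • y (-n) with ha
  set b : H := ∑ n ∈ c.support, (c n).im • y (-n) with hb
  have h1 : ∫ w, f w * trigPoly c w ∂freqMeasure =
      (inner ℝ η a : ℝ) + (inner ℝ η b : ℝ) * Complex.I := by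
    have : ∀ w, f w * trigPoly c w =
        ∑ n ∈ c.support, c n * (character (- -n) w * f w) := by
      intro w
      rw [trigPoly, Finset.mul_sum]
      refine Finset.sum_congr rfl fun n _ => ?_
      rw [neg_neg]
      ring
    simp_rw [this]
    rw [integral_finsetSum _ fun n _ => (Integrable.character_mul hf _).const_mul _]
    simp_rw [integral_const_mul, hfy, ha, hb, inner_sum, real_inner_smul_right]
    push_cast
    rw [Finset.sum_mul, ← Finset.sum_add_distrib]
    refine Finset.sum_congr rfl fun n _ => ?_
    conv_lhs => rw [← Complex.re_add_im (c n)]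
    ring
  -- The squared norm of that combination, computed from the spectral density `σ`; since `‖trigPoly
  -- c‖ ≤ 1`, it is at most `∫ ‖σ‖`. Cauchy–Schwarz on `a` and `b` then finishes.
  have h2 : (∫ w, (‖trigPoly c w‖ ^ 2 : ℝ) * σ w ∂freqMeasure).re = ‖a‖ ^ 2 + ‖b‖ ^ 2 := by
    have : ∀ w, ((‖trigPoly c w‖ ^ 2 : ℝ) : ℂ) * σ w =
        ∑ n ∈ c.support, ∑ m ∈ c.support,
          (c n * (starRingEnd ℂ) (c m)) * (character (-m - -n) w * σ w) := by
      intro w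
      rw [Complex.ofReal_pow, ← Complex.mul_conj', trigPoly, map_sum, Finset.sum_mul_sum,
        Finset.sum_mul]
      refine Finset.sum_congr rfl fun n _ => ?_
      rw [Finset.sum_mul]
      refine Finset.sum_congr rfl fun m _ => ?_
      rw [map_mul, conj_character, show -m - -n = n + -m by ring, character_add]
      ring
    simp_rw [this]
    rw [integral_finsetSum _ fun n _ => integrable_finsetSum _ fun m _ =>
      (Integrable.character_mul hσ _).const_mul _]
    simp_rw [integral_finsetSum _ fun m _ =>
      (Integrable.character_mul hσ _).const_mul _, integral_const_mul, hσy]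
    rw [← real_inner_self_eq_norm_sq, ← real_inner_self_eq_norm_sq, ha, hb]
    simp_rw [sum_inner, inner_sum, real_inner_smul_left, real_inner_smul_right,
      ← Finset.sum_add_distrib, Complex.re_sum]
    refine Finset.sum_congr rfl fun n _ => Finset.sum_congr rfl fun m _ => ?_
    rw [Complex.re_mul_ofReal, real_inner_comm]
    simp only [Complex.mul_re, Complex.conj_re, Complex.conj_im]
    ring
  have h3 : ‖a‖ ^ 2 + ‖b‖ ^ 2 ≤ ∫ w, ‖σ w‖ ∂freqMeasure := by
    rw [← h2]
    refine (Complex.re_le_norm _).trans ((norm_integral_le_integral_norm _).trans ?_)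
    refine integral_mono_of_nonneg (Eventually.of_forall fun w => norm_nonneg _) hσ.norm
      (Eventually.of_forall fun w => ?_)
    simp only [norm_mul, Complex.norm_real, Real.norm_eq_abs, abs_pow, abs_norm]
    exact mul_le_of_le_one_left (norm_nonneg _) (pow_le_one₀ (norm_nonneg _) (hc w))
  rw [h1, Complex.norm_add_mul_I]
  refine Real.sqrt_le_iff.2 ⟨by positivity, ?_⟩
  rw [mul_pow, Real.sq_sqrt (integral_nonneg fun w => norm_nonneg _)]
  have ea : (inner ℝ η a : ℝ) ^ 2 ≤ ‖η‖ ^ 2 * ‖a‖ ^ 2 := by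
    rw [← mul_pow, ← sq_abs]
    exact pow_le_pow_left₀ (abs_nonneg _) (abs_real_inner_le_norm _ _) 2
  have eb : (inner ℝ η b : ℝ) ^ 2 ≤ ‖η‖ ^ 2 * ‖b‖ ^ 2 := by
    rw [← mul_pow, ← sq_abs]
    exact pow_le_pow_left₀ (abs_nonneg _) (abs_real_inner_le_norm _ _) 2
  nlinarith [mul_le_mul_of_nonneg_left h3 (sq_nonneg ‖η‖)]

end FrequencyMeasure

/-! ### The transfer function of a projection in an abstract Hilbert-space setting. -/

section Projection

open Filter Topology Matrix

variable {H ν : Type*} [NormedAddCommGroup H] [InnerProductSpace ℝ H] [Fintype ν]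

/-- Every finite linear combination of the stationary family `z` has a transfer function `p`:
a vector of trigonometric polynomials that computes all its inner products from the cross-spectral
densities of `z`. -/
theorem exists_transferFunction {z : ℤ → ν → H} {ξ : H}
    (hξ : ξ ∈ Submodule.span ℝ (Set.range fun q : ℤ × ν => z q.1 q.2)) :
    ∃ p : ℝ → ν → ℂ,
      (∀ j (u : ℝ → ℂ), Integrable u freqMeasure →
        Integrable (fun w => p w j * u w) freqMeasure) ∧
      ∀ (u : ℝ → ν → ℂ) (y : ℤ → H), (∀ j, Integrable (fun w => u w j) freqMeasure) →
        (∀ s j τ, ∫ w, character (s - τ) w * u w j ∂freqMeasure = (inner ℝ (z s j) (y τ) : ℝ)) →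
        ∀ τ, ∫ w, character (-τ) w * (p w ⬝ᵥ u w) ∂freqMeasure = (inner ℝ ξ (y τ) : ℝ) := by
  classical
  induction hξ using Submodule.span_induction with
  | mem x hx =>
    obtain ⟨⟨s, j⟩, rfl⟩ := hx
    -- The generator `z s j` has transfer function `e^{iws}` in coordinate `j`; the other cases
    -- follow by linearity.
    refine ⟨fun w => Pi.single j (character s w), fun i u hu => ?_, fun u y hu huy τ => ?_⟩
    · by_cases h : i = j
      · subst h
        simpa using Integrable.character_mul hu s
      · simp [h]
    · simp only [single_dotProduct]
      rw [← huy]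
      refine integral_congr_ae (Eventually.of_forall fun w => ?_)
      simp only
      rw [show s - τ = -τ + s by ring, character_add, mul_assoc]
  | zero => exact ⟨0, by simp, by simp⟩
  | add ξ₁ ξ₂ _ _ h₁ h₂ =>
    obtain ⟨p₁, hp₁, hp₁'⟩ := h₁
    obtain ⟨p₂, hp₂, hp₂'⟩ := h₂
    refine ⟨p₁ + p₂, fun j u hu => ?_, fun u y hu huy τ => ?_⟩
    · simp only [Pi.add_apply, add_mul]
      exact (hp₁ j u hu).add (hp₂ j u hu)
    · have i₁ : Integrable (fun w => p₁ w ⬝ᵥ u w) freqMeasure :=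
        integrable_finsetSum _ fun j _ => hp₁ j _ (hu j)
      have i₂ : Integrable (fun w => p₂ w ⬝ᵥ u w) freqMeasure :=
        integrable_finsetSum _ fun j _ => hp₂ j _ (hu j)
      simp only [Pi.add_apply, add_dotProduct, mul_add, inner_add_left]
      rw [integral_add (Integrable.character_mul i₁ _) (Integrable.character_mul i₂ _),
        hp₁' u y hu huy, hp₂' u y hu huy]
      push_cast
      rfl
  | smul r ξ _ h =>
    obtain ⟨p, hp, hp'⟩ := h
    refine ⟨fun w => (r : ℂ) • p w, fun j u hu => ?_, fun u y hu huy τ => ?_⟩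
    · simpa [mul_assoc] using (hp j u hu).const_mul (r : ℂ)
    · simp only [smul_dotProduct, real_inner_smul_left, smul_eq_mul]
      simp_rw [mul_left_comm _ (r : ℂ), integral_const_mul, hp' u y hu huy]
      push_cast
      rfl

/-- A sequence of integrable functions that is Cauchy in the `L¹` sense has an `L¹` limit. -/
theorem exists_integrable_tendsto_of_cauchy {α E : Type*} [MeasurableSpace α] {m : Measure α}
    [NormedAddCommGroup E] [CompleteSpace E] {f : ℕ → α → E} (hf : ∀ n, Integrable (f n) m)
    {b : ℕ × ℕ → ℝ} (hb : Tendsto b atTop (𝓝 0))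
    (hfb : ∀ n k, ∫ x, ‖f n x - f k x‖ ∂m ≤ b (n, k)) :
    ∃ F : α → E, Integrable F m ∧ Tendsto (fun n => ∫ x, ‖f n x - F x‖ ∂m) atTop (𝓝 0) := by
  have hdist : ∀ n k, dist ((hf n).toL1 (f n)) ((hf k).toL1 (f k)) = ∫ x, ‖f n x - f k x‖ ∂m := by
    intro n k
    rw [dist_eq_norm, ← Integrable.toL1_sub, L1.norm_eq_integral_norm]
    refine integral_congr_ae ?_
    filter_upwards [Integrable.coeFn_toL1 ((hf n).sub (hf k))] with x hx
    rw [hx, Pi.sub_apply]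
  have hC : CauchySeq fun n => (hf n).toL1 (f n) := by
    rw [cauchySeq_iff_tendsto_dist_atTop_0]
    refine squeeze_zero (fun _ => dist_nonneg) (fun q => ?_) hb
    rw [hdist]
    exact hfb _ _
  obtain ⟨F, hF⟩ := cauchySeq_tendsto_of_complete hC
  refine ⟨F, L1.integrable_coeFn F, ?_⟩
  rw [tendsto_iff_dist_tendsto_zero] at hF
  refine hF.congr fun n => ?_
  rw [dist_eq_norm, L1.norm_eq_integral_norm]
  refine integral_congr_ae ?_
  filter_upwards [Lp.coeFn_sub ((hf n).toL1 (f n)) F, Integrable.coeFn_toL1 (hf n)] with x h1 h2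
  rw [h1, Pi.sub_apply, h2]

/-- Convergence of integrals to zero gives almost everywhere convergence along a subsequence. -/
theorem exists_seq_tendsto_ae_of_integral {α : Type*} [MeasurableSpace α] {m : Measure α}
    {g : ℕ → α → ℝ} (hg : ∀ n, Integrable (g n) m) (h0 : ∀ n x, 0 ≤ g n x)
    (hlim : Tendsto (fun n => ∫ x, g n x ∂m) atTop (𝓝 0)) :
    ∃ φ : ℕ → ℕ, StrictMono φ ∧ ∀ᵐ x ∂m, Tendsto (fun n => g (φ n) x) atTop (𝓝 0) := by
  have hm : TendstoInMeasure m g atTop (fun _ => 0) := by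
    refine tendstoInMeasure_of_tendsto_eLpNorm (p := 1) one_ne_zero
      (fun n => (hg n).aestronglyMeasurable) aestronglyMeasurable_const ?_
    have : ∀ n, eLpNorm (g n - fun _ => 0) 1 m = ENNReal.ofReal (∫ x, g n x ∂m) := by
      intro n
      rw [show (g n - fun _ => 0) = g n from sub_zero _, eLpNorm_one_eq_lintegral_enorm,
        ← ofReal_integral_norm_eq_lintegral_enorm (hg n)]
      congr 1
      refine integral_congr_ae (Eventually.of_forall fun x => ?_)
      simp [abs_of_nonneg (h0 n x)]
    simp_rw [this]
    simpa using ENNReal.tendsto_ofReal hlim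
  exact hm.exists_seq_tendsto_ae

/-- Let `ξ` be the orthogonal projection of `x` onto the closed span of the stationary family `z`.
Its transfer function is `S_{xz} S_z⁻¹`, so the cross-spectral density with any jointly
stationary `y` is `S_{xz} S_z⁻¹ S_{zy}`. -/
theorem integral_transfer_eq_inner [DecidableEq ν] {z : ℤ → ν → H} {x ξ : H} {y : ℤ → H} {t : ℤ}
    {Sxz : ℝ → ν → ℂ} {Sz : ℝ → Matrix ν ν ℂ} {Szy : ℝ → ν → ℂ} {Sy : ℝ → ℂ}
    (hξ : ξ ∈ (Submodule.span ℝ (Set.range fun q : ℤ × ν => z q.1 q.2)).topologicalClosure)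
    (horth : ∀ s k, (inner ℝ ξ (z s k) : ℝ) = inner ℝ x (z s k))
    (iSxz : ∀ k, Integrable (fun w => Sxz w k) freqMeasure)
    (iSz : ∀ j k, Integrable (fun w => Sz w j k) freqMeasure)
    (iSzy : ∀ j, Integrable (fun w => Szy w j) freqMeasure)
    (iSy : Integrable Sy freqMeasure)
    (hxz : ∀ s k, ∫ w, character (t - s) w * Sxz w k ∂freqMeasure = (inner ℝ x (z s k) : ℝ))
    (hz : ∀ s j τ k, ∫ w, character (s - τ) w * Sz w j k ∂freqMeasure =
      (inner ℝ (z s j) (z τ k) : ℝ))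
    (hzy : ∀ s j τ, ∫ w, character (s - τ) w * Szy w j ∂freqMeasure =
      (inner ℝ (z s j) (y τ) : ℝ))
    (hy : ∀ s τ, ∫ w, character (s - τ) w * Sy w ∂freqMeasure = (inner ℝ (y s) (y τ) : ℝ))
    (hinv : ∀ᵐ w ∂freqMeasure, IsUnit (Sz w).det) :
    Integrable (fun w => (Sxz w ᵥ* (Sz w)⁻¹) ⬝ᵥ Szy w) freqMeasure ∧
    ∀ s, ∫ w, character (t - s) w * ((Sxz w ᵥ* (Sz w)⁻¹) ⬝ᵥ Szy w) ∂freqMeasure =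
      (inner ℝ ξ (y s) : ℝ) := by
  obtain ⟨ξs, hξs, hlim⟩ := mem_closure_iff_seq_limit.1 hξ
  choose p hp hp' using fun n => exists_transferFunction (hξs n)
  have hnorm : Tendsto (fun n => ‖ξs n - ξ‖) atTop (𝓝 0) := by
    simpa using (hlim.sub_const ξ).norm
  -- convergence of `p_n S_z` to the shifted `S_{xz}`
  have iA : ∀ n k, Integrable (fun w => p n w ⬝ᵥ (fun j => Sz w j k)) freqMeasure := fun n k =>
    integrable_finsetSum _ fun j _ => hp n j _ (iSz j k)
  have iB : ∀ k, Integrable (fun w => character t w * Sxz w k) freqMeasure := fun k =>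
    Integrable.character_mul (iSxz k) t
  -- As `ξ` and `x` have the same inner products with every `z s k`, the difference inside the norm
  -- is the density of `ξ_n - ξ` with `z · k`.
  have hA : ∀ n k, ∫ w, ‖p n w ⬝ᵥ (fun j => Sz w j k) - character t w * Sxz w k‖ ∂freqMeasure ≤
      ‖ξs n - ξ‖ * √(∫ w, ‖Sz w k k‖ ∂freqMeasure) := by
    intro n k
    refine integral_norm_le_of_inner (y := fun τ => z τ k) ((iA n k).sub (iB k)) (iSz k k)
      (fun τ => ?_) (fun s τ => hz s k τ k)
    simp_rw [mul_sub]
    rw [integral_sub (Integrable.character_mul (iA n k) _) (Integrable.character_mul (iB k) _),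
      hp' n (fun w j => Sz w j k) (fun τ => z τ k) (fun j => iSz j k) (fun s j τ => hz s j τ k)]
    simp_rw [← mul_assoc, ← character_add]
    rw [show -τ + t = t - τ by ring, hxz, inner_sub_left, horth]
    push_cast
    rfl
  -- `L¹` limit of `p_n S_{zy}`
  have iD : ∀ n, Integrable (fun w => p n w ⬝ᵥ Szy w) freqMeasure := fun n =>
    integrable_finsetSum _ fun j _ => hp n j _ (iSzy j)
  have hD : ∀ n k, ∫ w, ‖p n w ⬝ᵥ Szy w - p k w ⬝ᵥ Szy w‖ ∂freqMeasure ≤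
      ‖ξs n - ξs k‖ * √(∫ w, ‖Sy w‖ ∂freqMeasure) := by
    intro n k
    refine integral_norm_le_of_inner (y := y) ((iD n).sub (iD k)) iSy (fun τ => ?_) hy
    simp_rw [mul_sub]
    rw [integral_sub (Integrable.character_mul (iD n) _) (Integrable.character_mul (iD k) _),
      hp' n Szy y iSzy hzy, hp' k Szy y iSzy hzy, inner_sub_left]
    push_cast
    rfl
  obtain ⟨F, iF, hF⟩ := exists_integrable_tendsto_of_cauchy iD
    (b := fun q => ‖ξs q.1 - ξs q.2‖ * √(∫ w, ‖Sy w‖ ∂freqMeasure)) (by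
      have := (cauchySeq_iff_tendsto_dist_atTop_0.1 hlim.cauchySeq).mul_const
        (√(∫ w, ‖Sy w‖ ∂freqMeasure))
      simpa [dist_eq_norm] using this) hD
  have iE : ∀ n k, Integrable
      (fun w => ‖p n w ⬝ᵥ (fun j => Sz w j k) - character t w * Sxz w k‖) freqMeasure :=
    fun n k => ((iA n k).sub (iB k)).norm
  have iE' : ∀ n, Integrable
      (fun w => ∑ k, ‖p n w ⬝ᵥ (fun j => Sz w j k) - character t w * Sxz w k‖) freqMeasure :=
    fun n => integrable_finsetSum _ fun k _ => iE n k
  have iG : ∀ n, Integrable (fun w => ‖p n w ⬝ᵥ Szy w - F w‖) freqMeasure :=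
    fun n => ((iD n).sub iF).norm
  -- a common almost everywhere convergent subsequence
  obtain ⟨φ, hφ, hae⟩ := exists_seq_tendsto_ae_of_integral (m := freqMeasure)
    (g := fun n w => (∑ k, ‖p n w ⬝ᵥ (fun j => Sz w j k) - character t w * Sxz w k‖) +
      ‖p n w ⬝ᵥ Szy w - F w‖)
    (fun n => (iE' n).add (iG n))
    (fun n w => by positivity) (by
      have : ∀ n, ∫ w, ((∑ k, ‖p n w ⬝ᵥ (fun j => Sz w j k) - character t w * Sxz w k‖) +
          ‖p n w ⬝ᵥ Szy w - F w‖) ∂freqMeasure =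
          (∑ k, ∫ w, ‖p n w ⬝ᵥ (fun j => Sz w j k) - character t w * Sxz w k‖ ∂freqMeasure) +
          ∫ w, ‖p n w ⬝ᵥ Szy w - F w‖ ∂freqMeasure := by
        intro n
        rw [integral_add (iE' n) (iG n), integral_finsetSum _ fun k _ => iE n k]
      simp_rw [this]
      have h1 : Tendsto (fun n => ∑ k, ∫ w,
          ‖p n w ⬝ᵥ (fun j => Sz w j k) - character t w * Sxz w k‖ ∂freqMeasure)
          atTop (𝓝 (∑ _k : ν, 0)) := by
        refine tendsto_finsetSum _ fun k _ => ?_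
        refine squeeze_zero (fun n => integral_nonneg fun w => norm_nonneg _)
          (fun n => hA n k) ?_
        simpa using hnorm.mul_const (√(∫ w, ‖Sz w k k‖ ∂freqMeasure))
      simpa using h1.add hF)
  have hFeq : ∀ᵐ w ∂freqMeasure,
      F w = character t w * ((Sxz w ᵥ* (Sz w)⁻¹) ⬝ᵥ Szy w) := by
    filter_upwards [hae, hinv] with w hw hu
    have l1 : Tendsto (fun n => p (φ n) w ᵥ* Sz w) atTop (𝓝 (character t w • Sxz w)) := by
      rw [tendsto_pi_nhds]
      intro k
      rw [tendsto_iff_norm_sub_tendsto_zero]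
      refine squeeze_zero (fun _ => norm_nonneg _) (fun n => ?_) hw
      have := Finset.single_le_sum
        (f := fun k => ‖p (φ n) w ⬝ᵥ (fun j => Sz w j k) - character t w * Sxz w k‖)
        (fun k _ => norm_nonneg _) (Finset.mem_univ k)
      refine this.trans (le_add_of_nonneg_right (norm_nonneg _))
    have l2 : Tendsto (fun n => p (φ n) w ⬝ᵥ Szy w) atTop (𝓝 (F w)) := by
      rw [tendsto_iff_norm_sub_tendsto_zero]
      refine squeeze_zero (fun _ => norm_nonneg _) (fun n => ?_) hw
      exact le_add_of_nonneg_left (Finset.sum_nonneg fun k _ => norm_nonneg _)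
    -- At a fixed frequency, multiplying by `(Sz w)⁻¹` is continuous and undoes `Sz w`, so the limit
    -- of `p_n S_z` determines that of `p_n S_{zy}`.
    have hcont : Continuous fun v : ν → ℂ => (v ᵥ* (Sz w)⁻¹) ⬝ᵥ Szy w := by fun_prop
    have l3 := (hcont.tendsto _).comp l1
    have e : ∀ n, ((p (φ n) w ᵥ* Sz w) ᵥ* (Sz w)⁻¹) ⬝ᵥ Szy w = p (φ n) w ⬝ᵥ Szy w := by
      intro n
      rw [vecMul_vecMul, mul_nonsing_inv _ hu, vecMul_one]
    have l4 : Tendsto (fun n => p (φ n) w ⬝ᵥ Szy w) atTop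
        (𝓝 (((character t w • Sxz w) ᵥ* (Sz w)⁻¹) ⬝ᵥ Szy w)) :=
      l3.congr e
    rw [tendsto_nhds_unique l2 l4, smul_vecMul, smul_dotProduct, smul_eq_mul]
  have hQ : ∀ᵐ w ∂freqMeasure,
      character (-t) w * F w = (Sxz w ᵥ* (Sz w)⁻¹) ⬝ᵥ Szy w := by
    filter_upwards [hFeq] with w hw
    rw [hw, ← mul_assoc, ← character_add]
    simp
  refine ⟨(Integrable.character_mul iF (-t)).congr hQ, fun s => ?_⟩
  have e1 : ∫ w, character (t - s) w * ((Sxz w ᵥ* (Sz w)⁻¹) ⬝ᵥ Szy w) ∂freqMeasure =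
      ∫ w, character (-s) w * F w ∂freqMeasure := by
    refine integral_congr_ae ?_
    filter_upwards [hFeq] with w hw
    rw [hw, show t - s = -s + t by ring, character_add, mul_assoc]
  rw [e1]
  have l1 : Tendsto (fun n => ∫ w, character (-s) w * (p n w ⬝ᵥ Szy w) ∂freqMeasure) atTop
      (𝓝 (∫ w, character (-s) w * F w ∂freqMeasure)) := by
    rw [tendsto_iff_norm_sub_tendsto_zero]
    refine squeeze_zero (fun _ => norm_nonneg _) (fun n => ?_) hF
    rw [← integral_sub (Integrable.character_mul (iD n) _) (Integrable.character_mul iF _)]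
    refine (norm_integral_le_integral_norm _).trans (le_of_eq ?_)
    refine integral_congr_ae (Eventually.of_forall fun w => ?_)
    simp only [← mul_sub, norm_mul, norm_character, one_mul]
  have l2 : Tendsto (fun n => ∫ w, character (-s) w * (p n w ⬝ᵥ Szy w) ∂freqMeasure) atTop
      (𝓝 ((inner ℝ ξ (y s) : ℝ) : ℂ)) := by
    simp_rw [fun n => hp' n Szy y iSzy hzy s]
    exact (Complex.continuous_ofReal.tendsto _).comp (hlim.inner tendsto_const_nhds)
  exact tendsto_nhds_unique l1 l2

end Projection

/-! ### Prediction errors as Hilbert-space residuals, and their covariances as frequency averages.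
-/

section LinearPrediction

variable {Ω ι κ ν : Type*} [MeasurableSpace Ω] {μ : Measure Ω}

theorem coeFn_toL2 {f : Ω → ℝ} (hf : MemLp f 2 μ) : toL2 μ f =ᵐ[μ] f := by
  rw [toL2, dif_pos hf]
  exact hf.coeFn_toLp

theorem inner_toL2 {f g : Ω → ℝ} (hf : MemLp f 2 μ) (hg : MemLp g 2 μ) :
    (inner ℝ (toL2 μ f) (toL2 μ g) : ℝ) = ∫ ω, f ω * g ω ∂μ := by
  rw [L2.inner_def]
  refine integral_congr_ae ?_
  filter_upwards [coeFn_toL2 hf, coeFn_toL2 hg] with ω h1 h2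
  rw [h1, h2, real_inner_eq_re_inner, RCLike.inner_apply]
  simp [mul_comm]

theorem IsWeaklyStationary.isJointlyWeaklyStationary {X : TimeSeries Ω ι}
    (hX : IsWeaklyStationary μ X) : IsJointlyWeaklyStationary μ X X := hX.cov_eq

theorem crossCov_transpose (X : TimeSeries Ω ι) (Y : TimeSeries Ω κ) (s t : ℤ) :
    (crossCov μ X Y s t).transpose = crossCov μ Y X t s := by
  ext i j
  exact covariance_comm _ _

theorem IsJointlyWeaklyStationary.crossCov_eq {X : TimeSeries Ω ι} {Y : TimeSeries Ω κ}
    (h : IsJointlyWeaklyStationary μ X Y) (s t : ℤ) :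
    crossCov μ X Y s t = crossCovFun μ X Y (s - t) := by
  have := h t (s - t)
  rwa [add_sub_cancel] at this

theorem IsJointlyWeaklyStationary.symm {X : TimeSeries Ω ι} {Y : TimeSeries Ω κ}
    (h : IsJointlyWeaklyStationary μ X Y) : IsJointlyWeaklyStationary μ Y X := by
  intro t k
  rw [← crossCov_transpose, ← crossCov_transpose X Y, h.crossCov_eq, h.crossCov_eq]
  congr 2
  ring

theorem freqAvg_apply (S : ℝ → Matrix ι κ ℂ) (i : ι) (j : κ) :
    freqAvg S i j = ∫ w, S w i j ∂freqMeasure := by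
  rw [integral_freqMeasure]
  rfl

theorem freqIntegrable_iff {S : ℝ → Matrix ι κ ℂ} :
    FreqIntegrable S ↔ ∀ i j, Integrable (fun w => S w i j) freqMeasure := by
  simp only [FreqIntegrable, integrable_freqMeasure_iff]

theorem one_mem_predictorSpace {Z : TimeSeries Ω ν} :
    toL2 μ (fun _ => (1 : ℝ)) ∈ predictorSpace μ Z :=
  Submodule.le_topologicalClosure _ (Submodule.subset_span (Set.mem_insert _ _))

variable (μ) in
/-- The class in `L²(μ)` of the centred random variable `f - E f`. -/
def centered (f : Ω → ℝ) : Lp ℝ 2 μ := toL2 μ fun ω => f ω - ∫ ω', f ω' ∂μ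

variable (μ) in
/-- The closed span of the centred components of the process `Z`. -/
def centeredSpace (Z : TimeSeries Ω ν) : Submodule ℝ (Lp ℝ 2 μ) :=
  (Submodule.span ℝ (Set.range fun q : ℤ × ν =>
    centered μ fun ω => Z q.1 ω q.2)).topologicalClosure

instance completeSpace_centeredSpace (Z : TimeSeries Ω ν) :
    CompleteSpace (centeredSpace μ Z) :=
  (Submodule.isClosed_topologicalClosure _).completeSpace_coe

variable (μ) in
/-- The `L²` class of the error of linear prediction of `f` from the process `Z`. -/
def predictionError (Z : TimeSeries Ω ν) (f : Ω → ℝ) : Lp ℝ 2 μ :=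
  centered μ f - (centeredSpace μ Z).starProjection (centered μ f)

variable {Z : TimeSeries Ω ν}

theorem centered_mem_centeredSpace (s : ℤ) (j : ν) :
    centered μ (fun ω => Z s ω j) ∈ centeredSpace μ Z :=
  Submodule.le_topologicalClosure _ (Submodule.subset_span ⟨(s, j), rfl⟩)

theorem inner_predictionError_of_mem {f : Ω → ℝ} {v : Lp ℝ 2 μ} (hv : v ∈ centeredSpace μ Z) :
    (inner ℝ (predictionError μ Z f) v : ℝ) = 0 :=
  Submodule.starProjection_inner_eq_zero _ v hv

variable [IsProbabilityMeasure μ]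

theorem MeasureTheory.MemLp.sub_mean {f : Ω → ℝ} (hf : MemLp f 2 μ) :
    MemLp (fun ω => f ω - ∫ ω', f ω' ∂μ) 2 μ := hf.sub (memLp_const _)

theorem inner_centered {f g : Ω → ℝ} (hf : MemLp f 2 μ) (hg : MemLp g 2 μ) :
    (inner ℝ (centered μ f) (centered μ g) : ℝ) = cov[f, g; μ] :=
  inner_toL2 (MemLp.sub_mean hf) (MemLp.sub_mean hg)

theorem toL2_eq_centered_add {f : Ω → ℝ} (hf : MemLp f 2 μ) :
    toL2 μ f = centered μ f + (∫ ω, f ω ∂μ) • toL2 μ (fun _ => (1 : ℝ)) := by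
  refine Lp.ext ?_
  filter_upwards [coeFn_toL2 hf, coeFn_toL2 (MemLp.sub_mean hf),
    coeFn_toL2 (μ := μ) (memLp_const (1 : ℝ)),
    Lp.coeFn_add (centered μ f) ((∫ ω, f ω ∂μ) • toL2 μ (fun _ => (1 : ℝ))),
    Lp.coeFn_smul (∫ ω, f ω ∂μ) (toL2 μ (fun _ => (1 : ℝ)))] with ω h1 h2 h3 h4 h5
  rw [h4, Pi.add_apply, h5, Pi.smul_apply, h1, h3, centered, h2]
  simp

theorem inner_centered_one {f : Ω → ℝ} (hf : MemLp f 2 μ) :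
    (inner ℝ (centered μ f) (toL2 μ fun _ => (1 : ℝ)) : ℝ) = 0 := by
  rw [centered, inner_toL2 (MemLp.sub_mean hf) (memLp_const _)]
  simp only [mul_one]
  rw [integral_sub (hf.integrable one_le_two) (integrable_const _)]
  simp

theorem inner_one_of_mem (hZ : ∀ t j, MemLp (fun ω => Z t ω j) 2 μ) {v : Lp ℝ 2 μ}
    (hv : v ∈ centeredSpace μ Z) : (inner ℝ v (toL2 μ fun _ => (1 : ℝ)) : ℝ) = 0 := by
  have h : centeredSpace μ Z ≤ (ℝ ∙ (toL2 μ fun _ => (1 : ℝ)))ᗮ := by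
    refine Submodule.topologicalClosure_minimal _ ?_ (Submodule.isClosed_orthogonal _)
    rw [Submodule.span_le]
    rintro _ ⟨⟨s, j⟩, rfl⟩
    rw [SetLike.mem_coe, Submodule.mem_orthogonal_singleton_iff_inner_left]
    exact inner_centered_one (hZ s j)
  exact Submodule.mem_orthogonal_singleton_iff_inner_left.1 (h hv)

theorem inner_predictionError_one (hZ : ∀ t j, MemLp (fun ω => Z t ω j) 2 μ) {f : Ω → ℝ}
    (hf : MemLp f 2 μ) :
    (inner ℝ (predictionError μ Z f) (toL2 μ fun _ => (1 : ℝ)) : ℝ) = 0 := by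
  rw [predictionError, inner_sub_left, inner_centered_one hf,
    inner_one_of_mem hZ (Submodule.starProjection_apply_mem _ _), sub_zero]

theorem centeredSpace_le (hZ : ∀ t j, MemLp (fun ω => Z t ω j) 2 μ) :
    centeredSpace μ Z ≤ predictorSpace μ Z := by
  refine Submodule.topologicalClosure_minimal _ ?_ (Submodule.isClosed_topologicalClosure _)
  rw [Submodule.span_le]
  rintro _ ⟨⟨s, j⟩, rfl⟩
  have h := toL2_eq_centered_add (hZ s j)
  rw [← sub_eq_iff_eq_add] at h
  change centered μ (fun ω => Z s ω j) ∈ predictorSpace μ Z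
  rw [← h]
  refine Submodule.sub_mem _ ?_ (Submodule.smul_mem _ _ one_mem_predictorSpace)
  exact Submodule.le_topologicalClosure _
    (Submodule.subset_span (Set.mem_insert_of_mem _ ⟨(s, j), rfl⟩))

/-- The predictor space is the orthogonal sum of the constants and `centeredSpace`, so predicting
`f` amounts to adding its mean to the projection of `f - E f`. The candidate `v` is verified by
membership and orthogonality of the residual. -/
theorem toL2_sub_linearPredictor (hZ : ∀ t j, MemLp (fun ω => Z t ω j) 2 μ) {f : Ω → ℝ}
    (hf : MemLp f 2 μ) : toL2 μ f - linearPredictor μ Z f = predictionError μ Z f := by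
  have : CompleteSpace (predictorSpace μ Z) :=
    (Submodule.isClosed_topologicalClosure _).completeSpace_coe
  set v : Lp ℝ 2 μ := (centeredSpace μ Z).starProjection (centered μ f) +
    (∫ ω, f ω ∂μ) • toL2 μ (fun _ => (1 : ℝ)) with hv
  have hres : toL2 μ f - v = predictionError μ Z f := by
    rw [hv, toL2_eq_centered_add hf, predictionError]
    abel
  have hmem : v ∈ predictorSpace μ Z :=
    Submodule.add_mem _ (centeredSpace_le hZ (Submodule.starProjection_apply_mem _ _))
      (Submodule.smul_mem _ _ one_mem_predictorSpace)
  have horth : predictorSpace μ Z ≤ (ℝ ∙ predictionError μ Z f)ᗮ := by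
    refine Submodule.topologicalClosure_minimal _ ?_ (Submodule.isClosed_orthogonal _)
    rw [Submodule.span_le]
    rintro w hw
    rw [SetLike.mem_coe, Submodule.mem_orthogonal_singleton_iff_inner_right]
    rcases hw with rfl | ⟨⟨s, j⟩, rfl⟩
    · exact inner_predictionError_one hZ hf
    · simp only
      rw [toL2_eq_centered_add (hZ s j), inner_add_right, inner_smul_right,
        inner_predictionError_one hZ hf, inner_predictionError_of_mem
          (centered_mem_centeredSpace s j)]
      simp
  have hP : (predictorSpace μ Z).starProjection (toL2 μ f) = v := by
    refine Submodule.eq_starProjection_of_mem_of_inner_eq_zero hmem fun w hw => ?_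
    rw [hres]
    exact Submodule.mem_orthogonal_singleton_iff_inner_right.1 (horth hw)
  rw [linearPredictor, hP, hres]

theorem linCondCov_apply (hZ : ∀ t j, MemLp (fun ω => Z t ω j) 2 μ) {X : TimeSeries Ω ι}
    {Y : TimeSeries Ω κ} (hX : ∀ t i, MemLp (fun ω => X t ω i) 2 μ)
    (hY : ∀ t i, MemLp (fun ω => Y t ω i) 2 μ) (t : ℤ) (i : ι) (j : κ) :
    linCondCov μ X Y Z t i j = (inner ℝ (predictionError μ Z fun ω => X t ω i)
      (predictionError μ Z fun ω => Y t ω j) : ℝ) := by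
  -- Residuals are orthogonal to `1`, hence have mean zero, and their covariance is a plain inner
  -- product.
  have key : ∀ f : Ω → ℝ, MemLp f 2 μ →
      (fun ω => f ω - linearPredictor μ Z f ω) =ᵐ[μ] predictionError μ Z f ∧
        ∫ ω, (f ω - linearPredictor μ Z f ω) ∂μ = 0 := by
    intro f hf
    have h1 : (fun ω => f ω - linearPredictor μ Z f ω) =ᵐ[μ] predictionError μ Z f := by
      rw [← toL2_sub_linearPredictor hZ hf]
      filter_upwards [coeFn_toL2 hf, Lp.coeFn_sub (toL2 μ f) (linearPredictor μ Z f)]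
        with ω h2 h3
      rw [h3, Pi.sub_apply, h2]
    refine ⟨h1, ?_⟩
    rw [← inner_predictionError_one hZ hf, L2.inner_def]
    refine integral_congr_ae ?_
    filter_upwards [h1, coeFn_toL2 (μ := μ) (memLp_const (1 : ℝ))] with ω h2 h3
    rw [h3, h2]
    simp
  obtain ⟨hx, hx0⟩ := key _ (hX t i)
  obtain ⟨hy, hy0⟩ := key _ (hY t j)
  simp only [linCondCov, crossCov, predResidual, Matrix.of_apply, covariance]
  rw [hx0, hy0, L2.inner_def]
  refine integral_congr_ae ?_
  filter_upwards [hx, hy] with ω h1 h2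
  rw [← h1, ← h2]
  simp [mul_comm]

/-- The residual of `f` is orthogonal to `centeredSpace`, so the projected part of `g` drops out. -/
theorem inner_predictionError_predictionError {f g : Ω → ℝ} (hf : MemLp f 2 μ) (hg : MemLp g 2 μ) :
    (inner ℝ (predictionError μ Z f) (predictionError μ Z g) : ℝ) = cov[f, g; μ] -
      inner ℝ ((centeredSpace μ Z).starProjection (centered μ f)) (centered μ g) := by
  have h : (inner ℝ (predictionError μ Z f) (predictionError μ Z g) : ℝ) =
      inner ℝ (predictionError μ Z f) (centered μ g) := by
    conv_lhs => rw [predictionError.eq_def μ Z g, inner_sub_right,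
      inner_predictionError_of_mem (Submodule.starProjection_apply_mem _ _), sub_zero]
  rw [h, predictionError, inner_sub_left, inner_centered hf hg]

theorem HasCrossSpectralDensity.integral_character {X : TimeSeries Ω ι} {Y : TimeSeries Ω κ}
    {S : ℝ → Matrix ι κ ℂ} (hS : HasCrossSpectralDensity μ X Y S)
    (h : IsJointlyWeaklyStationary μ X Y) (hX : ∀ t i, MemLp (fun ω => X t ω i) 2 μ)
    (hY : ∀ t i, MemLp (fun ω => Y t ω i) 2 μ) (s t : ℤ) (i : ι) (j : κ) :
    ∫ w, character (s - t) w * S w i j ∂freqMeasure =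
      (inner ℝ (centered μ fun ω => X s ω i) (centered μ fun ω => Y t ω j) : ℝ) := by
  have h1 := congrFun (congrFun (hS.fourier (s - t)) i) j
  rw [freqAvg_apply, Matrix.map_apply, ← h.crossCov_eq] at h1
  rw [inner_centered (hX s i) (hY t j)]
  exact h1.symm

/-- The prediction error covariance is the frequency average of the conditional spectral density,
which is integrable. -/
theorem linCondCov_eq_freqAvg [Fintype ν] [DecidableEq ν] {X : TimeSeries Ω ι}
    {Y : TimeSeries Ω κ} (hX : ∀ t i, MemLp (fun ω => X t ω i) 2 μ)
    (hY : IsWeaklyStationary μ Y) (hZ : IsWeaklyStationary μ Z)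
    (hXY : IsJointlyWeaklyStationary μ X Y) (hXZ : IsJointlyWeaklyStationary μ X Z)
    (hZY : IsJointlyWeaklyStationary μ Z Y)
    {SY : ℝ → Matrix κ κ ℂ} {SZ : ℝ → Matrix ν ν ℂ} {SXY : ℝ → Matrix ι κ ℂ}
    {SXZ : ℝ → Matrix ι ν ℂ} {SZY : ℝ → Matrix ν κ ℂ}
    (hSY : HasCrossSpectralDensity μ Y Y SY) (hSZ : HasCrossSpectralDensity μ Z Z SZ)
    (hSXY : HasCrossSpectralDensity μ X Y SXY) (hSXZ : HasCrossSpectralDensity μ X Z SXZ)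
    (hSZY : HasCrossSpectralDensity μ Z Y SZY)
    (hinv : ∀ᵐ w ∂(volume.restrict (Set.Icc (-Real.pi) Real.pi)), IsUnit (SZ w).det) :
    FreqIntegrable (condSpectralDensity SXY SXZ SZ SZY) ∧
    ∀ t, (linCondCov μ X Y Z t).map (fun x : ℝ => (x : ℂ)) =
      freqAvg (condSpectralDensity SXY SXZ SZ SZY) := by
  have hmain := fun (t : ℤ) (i : ι) (j : κ) => integral_transfer_eq_inner (t := t)
    (z := fun s k => centered μ fun ω => Z s ω k) (x := centered μ fun ω => X t ω i)
    (ξ := (centeredSpace μ Z).starProjection (centered μ fun ω => X t ω i))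
    (y := fun s => centered μ fun ω => Y s ω j)
    (Sxz := fun w => SXZ w i) (Sz := SZ) (Szy := fun w k => SZY w k j) (Sy := fun w => SY w j j)
    (Submodule.starProjection_apply_mem _ _)
    (fun s k => by
      have h := inner_predictionError_of_mem (μ := μ) (Z := Z) (f := fun ω => X t ω i)
        (centered_mem_centeredSpace s k)
      rw [predictionError, inner_sub_left, sub_eq_zero] at h
      exact h.symm)
    (fun k => freqIntegrable_iff.1 hSXZ.integrable i k)
    (freqIntegrable_iff.1 hSZ.integrable)
    (fun k => freqIntegrable_iff.1 hSZY.integrable k j)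
    (freqIntegrable_iff.1 hSY.integrable j j)
    (fun s k => hSXZ.integral_character hXZ hX hZ.memLp t s i k)
    (fun s k τ l => hSZ.integral_character hZ.isJointlyWeaklyStationary hZ.memLp hZ.memLp s τ k l)
    (fun s k τ => hSZY.integral_character hZY hZ.memLp hY.memLp s τ k j)
    (fun s τ => hSY.integral_character hY.isJointlyWeaklyStationary hY.memLp hY.memLp s τ j j)
    (ae_freqMeasure hinv)
  have hentry : ∀ w i j, condSpectralDensity SXY SXZ SZ SZY w i j = SXY w i j -
      Matrix.vecMul (SXZ w i) (SZ w)⁻¹ ⬝ᵥ (fun k => SZY w k j) := by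
    intro w i j
    rfl
  have iXY := freqIntegrable_iff.1 hSXY.integrable
  refine ⟨freqIntegrable_iff.2 fun i j => ?_, fun t => ?_⟩
  · simp_rw [hentry]
    exact (iXY i j).sub (hmain 0 i j).1
  · ext i j
    rw [freqAvg_apply, Matrix.map_apply, linCondCov_apply hZ.memLp hX hY.memLp,
      inner_predictionError_predictionError (hX t i) (hY.memLp t j)]
    simp_rw [hentry]
    rw [integral_sub (iXY i j) (hmain t i j).1, ← inner_centered (hX t i) (hY.memLp t j)]
    -- At lag zero the characters are `1`, and the Fourier coefficients become frequency averages.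
    have h1 := (hmain t i j).2 t
    have h2 := hSXY.integral_character hXY hX hY.memLp t t i j
    simp only [sub_self, character_zero, one_mul] at h1 h2
    rw [h1, h2]
    push_cast
    rfl

end LinearPrediction

/-! ### Determinant inequalities for positive semidefinite block matrices. -/

section Determinant

open Matrix
open scoped MatrixOrder

variable {m n : Type*} [Fintype m] [DecidableEq m] [Fintype n] [DecidableEq n]

theorem Matrix.PosSemidef.one_le_det_one_add {E : Matrix n n ℝ} (hE : E.PosSemidef) :
    1 ≤ (1 + E).det := by
  -- At `-1` the characteristic polynomial gives `det (1 + E) = ∏ (1 + λ_i)`, once the common sign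
  -- `(-1)^n` is cancelled.
  have h := congrArg (Polynomial.eval (-1)) hE.1.charpoly_eq
  rw [eval_charpoly, Polynomial.eval_prod] at h
  have e1 : scalar n (-1 : ℝ) - E = -(1 + E) := by
    rw [map_neg, map_one]
    abel
  have e2 : ∀ i, Polynomial.eval (-1)
      (Polynomial.X - Polynomial.C (RCLike.ofReal (hE.1.eigenvalues i) : ℝ)) =
      -(1 + hE.1.eigenvalues i) := by
    intro i
    simp
    ring
  rw [e1, det_neg, Finset.prod_congr rfl fun i _ => e2 i, Finset.prod_neg, Finset.card_univ] at h
  rw [mul_left_cancel₀ (pow_ne_zero _ (by norm_num)) h]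
  refine Finset.one_le_prod fun i _ => ?_
  linarith [hE.eigenvalues_nonneg i]

/-- For invertible `K = Rᴴ R`, congruence by `R` gives `A = Rᴴ (1 + E) R` with `E` positive
semidefinite, so `det A = det K * det (1 + E)`. For singular `K` the bound is nonnegativity of `det
A`. -/
theorem Matrix.PosSemidef.det_le_det {K A : Matrix n n ℝ} (hK : K.PosSemidef)
    (hAK : (A - K).PosSemidef) : K.det ≤ A.det := by
  have hA : A.PosSemidef := by simpa using hAK.add hK
  by_cases h0 : K.det = 0
  · rw [h0]
    exact hA.det_nonneg
  obtain ⟨R, hR⟩ := CStarAlgebra.nonneg_iff_eq_star_mul_self.1 hK.nonneg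
  rw [star_eq_conjTranspose] at hR
  have hRu : IsUnit R.det := by
    rw [isUnit_iff_ne_zero]
    intro hR0
    rw [hR, det_mul, hR0, mul_zero] at h0
    exact h0 rfl
  have hE : (R⁻¹ᴴ * (A - K) * R⁻¹).PosSemidef := hAK.conjTranspose_mul_mul_same _
  have hRT : Rᴴ * R⁻¹ᴴ = 1 := by
    rw [← conjTranspose_mul, nonsing_inv_mul _ hRu, conjTranspose_one]
  have hfac : A = Rᴴ * (1 + R⁻¹ᴴ * (A - K) * R⁻¹) * R := by
    calc A = K + (A - K) := by abel
      _ = Rᴴ * R + (Rᴴ * R⁻¹ᴴ) * (A - K) * (R⁻¹ * R) := by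
        rw [hRT, nonsing_inv_mul _ hRu, ← hR, one_mul, mul_one]
      _ = _ := by simp only [mul_add, add_mul, mul_assoc, mul_one]
  have hdet : A.det = K.det * (1 + R⁻¹ᴴ * (A - K) * R⁻¹).det := by
    conv_lhs => rw [hfac]
    rw [det_mul, det_mul, hR, det_mul]
    ring
  rw [hdet]
  exact le_mul_of_one_le_right hK.det_nonneg hE.one_le_det_one_add

/-- The explained part `B D⁻¹ Bᵀ` of a positive semidefinite block matrix has a determinant between
`0` and `det A`. For singular `D`, both hold because then `D⁻¹ = 0`. -/
theorem Matrix.det_mul_inv_mul_mem_Icc {A : Matrix m m ℝ} {B : Matrix m n ℝ} {D : Matrix n n ℝ}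
    (h : (fromBlocks A B Bᴴ D).PosSemidef) :
    (B * D⁻¹ * Bᴴ).det ∈ Set.Icc 0 A.det := by
  have hD : D.PosSemidef := h.submatrix Sum.inr
  have hA : A.PosSemidef := h.submatrix Sum.inl
  have hK : (B * D⁻¹ * Bᴴ).PosSemidef := hD.inv.mul_mul_conjTranspose_same B
  refine ⟨hK.det_nonneg, hK.det_le_det ?_⟩
  by_cases h0 : D.det = 0
  · rw [nonsing_inv_apply_not_isUnit D (by simpa using h0)]
    simpa using hA
  · have hD' := hD.posDef_iff_det_ne_zero.2 h0
    have := hD'.isUnit.invertible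
    exact (PosDef.fromBlocks₂₂ A B hD').1 h

/-- The adjugate formula for the inverse also covers singular `D`, where both sides are `0`. -/
theorem Matrix.map_ofReal_inv (D : Matrix n n ℝ) :
    D⁻¹.map (fun x : ℝ => (x : ℂ)) = (D.map fun x : ℝ => (x : ℂ))⁻¹ := by
  have hdet : (D.map fun x : ℝ => (x : ℂ)).det = (D.det : ℂ) :=
    (Complex.ofRealHom.map_det D).symm
  have hadj : (D.map fun x : ℝ => (x : ℂ)).adjugate = D.adjugate.map fun x : ℝ => (x : ℂ) :=
    (Complex.ofRealHom.map_adjugate D).symm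
  rw [inv_def, inv_def, hdet, hadj, Ring.inverse_eq_inv', Ring.inverse_eq_inv']
  ext i j
  simp

end Determinant

/-! ### Assembly of the theorem. -/

theorem mainTheorem1 {Ω : Type*} [MeasurableSpace Ω] (μ : Measure Ω) [IsProbabilityMeasure μ]
    {ι κ ν : Type*} [Fintype ι] [DecidableEq ι] [Fintype κ] [DecidableEq κ]
    [Fintype ν] [DecidableEq ν]
    (X : TimeSeries Ω ι) (Y : TimeSeries Ω κ) (Z : TimeSeries Ω ν)
    (hX : IsWeaklyStationary μ X) (hY : IsWeaklyStationary μ Y) (hZ : IsWeaklyStationary μ Z)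
    (hXY : IsJointlyWeaklyStationary μ X Y) (hXZ : IsJointlyWeaklyStationary μ X Z)
    (hYZ : IsJointlyWeaklyStationary μ Y Z)
    (SX : ℝ → Matrix ι ι ℂ) (SY : ℝ → Matrix κ κ ℂ) (SZ : ℝ → Matrix ν ν ℂ)
    (SXY : ℝ → Matrix ι κ ℂ) (SYX : ℝ → Matrix κ ι ℂ)
    (SXZ : ℝ → Matrix ι ν ℂ) (SZX : ℝ → Matrix ν ι ℂ)
    (SYZ : ℝ → Matrix κ ν ℂ) (SZY : ℝ → Matrix ν κ ℂ)
    (hSX : HasCrossSpectralDensity μ X X SX) (hSY : HasCrossSpectralDensity μ Y Y SY)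
    (hSZ : HasCrossSpectralDensity μ Z Z SZ)
    (hSXY : HasCrossSpectralDensity μ X Y SXY) (hSYX : HasCrossSpectralDensity μ Y X SYX)
    (hSXZ : HasCrossSpectralDensity μ X Z SXZ) (hSZX : HasCrossSpectralDensity μ Z X SZX)
    (hSYZ : HasCrossSpectralDensity μ Y Z SYZ) (hSZY : HasCrossSpectralDensity μ Z Y SZY)
    (hinv : ∀ᵐ w ∂(volume.restrict (Set.Icc (-Real.pi) Real.pi)), IsUnit (SZ w).det) :
    let SXgZ : ℝ → Matrix ι ι ℂ := condSpectralDensity SX SXZ SZ SZX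
    let SYgZ : ℝ → Matrix κ κ ℂ := condSpectralDensity SY SYZ SZ SZY
    let SXYgZ : ℝ → Matrix ι κ ℂ := condSpectralDensity SXY SXZ SZ SZY
    let SYXgZ : ℝ → Matrix κ ι ℂ := condSpectralDensity SYX SYZ SZ SZX
    (FreqIntegrable SXgZ ∧ FreqIntegrable SYgZ ∧ FreqIntegrable SXYgZ ∧ FreqIntegrable SYXgZ) ∧
    (∀ t : ℤ,
      (linCondVar μ X Z t).map (fun x : ℝ => (x : ℂ)) = freqAvg SXgZ ∧
      (linCondVar μ Y Z t).map (fun x : ℝ => (x : ℂ)) = freqAvg SYgZ ∧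
      (linCondCov μ X Y Z t).map (fun x : ℝ => (x : ℂ)) = freqAvg SXYgZ) ∧
    ((freqAvg SXgZ).PosDef →
      ∃ r ∈ Set.Icc (0 : ℝ) 1,
        1 - (freqAvg SXYgZ * (freqAvg SYgZ)⁻¹ * freqAvg SYXgZ).det / (freqAvg SXgZ).det
          = (r : ℂ)) := by
  intro SXgZ SYgZ SXYgZ SYXgZ
  obtain ⟨iX, eX⟩ := linCondCov_eq_freqAvg hX.memLp hX hZ hX.isJointlyWeaklyStationary hXZ
    hXZ.symm hSX hSZ hSX hSXZ hSZX hinv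
  obtain ⟨iY, eY⟩ := linCondCov_eq_freqAvg hY.memLp hY hZ hY.isJointlyWeaklyStationary hYZ
    hYZ.symm hSY hSZ hSY hSYZ hSZY hinv
  obtain ⟨iXY, eXY⟩ := linCondCov_eq_freqAvg hX.memLp hY hZ hXY hXZ hYZ.symm hSY hSZ hSXY hSXZ
    hSZY hinv
  obtain ⟨iYX, eYX⟩ := linCondCov_eq_freqAvg hY.memLp hX hZ hXY.symm hYZ hXZ.symm hSX hSZ hSYX
    hSYZ hSZX hinv
  refine ⟨⟨iX, iY, iXY, iYX⟩, fun t => ⟨eX t, eY t, eXY t⟩, fun _ => ?_⟩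
  -- Any time would do, since the frequency averages do not depend on `t`.
  set A := linCondCov μ X X Z 0 with hA
  set B := linCondCov μ X Y Z 0 with hB
  set D := linCondCov μ Y Y Z 0 with hD
  have hBT : linCondCov μ Y X Z 0 = B.conjTranspose := by
    rw [Matrix.conjTranspose_eq_transpose_of_trivial]
    exact (crossCov_transpose _ _ _ _).symm
  -- The block matrix is the Gram matrix of all residuals of `X_0` and `Y_0` together.
  have hgram : (Matrix.fromBlocks A B B.conjTranspose D).PosSemidef := by
    have hG := Matrix.posSemidef_gram ℝ (Sum.elim
      (fun i => predictionError μ Z fun ω => X 0 ω i)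
      (fun j => predictionError μ Z fun ω => Y 0 ω j))
    refine (congrArg Matrix.PosSemidef ?_).mpr hG
    rw [← hBT]
    ext (i | i) (j | j)
    · exact linCondCov_apply hZ.memLp hX.memLp hX.memLp 0 i j
    · exact linCondCov_apply hZ.memLp hX.memLp hY.memLp 0 i j
    · exact linCondCov_apply hZ.memLp hY.memLp hX.memLp 0 i j
    · exact linCondCov_apply hZ.memLp hY.memLp hY.memLp 0 i j
  obtain ⟨h0, h1⟩ := Matrix.det_mul_inv_mul_mem_Icc hgram
  have hratio0 := div_nonneg h0 (h0.trans h1)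
  have hratio1 := div_le_one_of_le₀ h1 (h0.trans h1)
  refine ⟨1 - (B * D⁻¹ * B.conjTranspose).det / A.det, ⟨by linarith, by linarith⟩, ?_⟩
  have hdet : ∀ {n : Type _} [Fintype n] [DecidableEq n] (M : Matrix n n ℝ),
      (M.map fun x : ℝ => (x : ℂ)).det = (M.det : ℂ) :=
    fun M => (Complex.ofRealHom.map_det M).symm
  rw [← eX 0, ← eY 0, ← eXY 0, ← eYX 0, ← hA, ← hB, ← hD, hBT, ← Matrix.map_ofReal_inv, hdet]
  have hmul : B.map (fun x : ℝ => (x : ℂ)) * D⁻¹.map (fun x : ℝ => (x : ℂ)) *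
      B.conjTranspose.map (fun x : ℝ => (x : ℂ)) =
      (B * D⁻¹ * B.conjTranspose).map fun x : ℝ => (x : ℂ) := by
    have h2 := Matrix.map_mul (f := Complex.ofRealHom) (L := B * D⁻¹) (M := B.conjTranspose)
    have h3 := Matrix.map_mul (f := Complex.ofRealHom) (L := B) (M := D⁻¹)
    rw [h3] at h2
    exact h2.symm
  rw [hmul, hdet]
  push_cast
  rfl

end
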